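/- For a positive integer $D$ that is not a perfect square, let $(u_1,v_1)$ be the least solution of $u^2-Dv^2=1$ in positive integers, and let $h(4D)$ be the class number of primitive binary quadratic forms of discriminant $4D$, i.e. the number of $\mathrm{SL}_2(\mathbb{Z})$-equivalence classes of forms $ax^2+bxy+cy^2$ with $a,b,c\in\mathbb{Z}$, $\gcd(a,b,c)=1$ and $b^2-4ac=4D$. For $D$ odd, we say that the generalized Ankeny–Artin–Chowla conjecture (GAAC) is true for $D$ if $v_1h(4D)\not\equiv 0\pmod D$. **Theorem.** (1) Let $n$ be a positive integer such that $D=n^2-1$ is squarefree. Then $\varepsilon=n+\sqrt{n^2-1}$ is the fundamental unit of $\mathbb{Q}(\sqrt D)$; that is, $\varepsilon>1$ is a unit of the ring of integers of $\mathbb{Q}(\sqrt D)\subset\mathbb{R}$, and every unit of this ring is of the form $\pm\varepsilon^k$ with $k\in\mathbb{Z}$. (2) There is a constant $D_0$ such that every squarefree $D\ge D_0$ of the form $D=n^2-1$ with $n$ a positive integer is odd and not a perfect square, and GAAC is true for $D$. (3) There are infinitely many squarefree $D$ of the form $n^2-1$, odd and not perfect squares, for which GAAC is true. -/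

import Mathlib

open scoped NumberField MatrixGroups

/-- The binary quadratic form `a x² + b x y + c y²` with integer coefficients. -/
@[ext]
structure BinForm where
  a : ℤ
  b : ℤ
  c : ℤ

namespace BinForm

/-- The value `f(x, y) = a x² + b x y + c y²`. -/
def eval (f : BinForm) (x y : ℤ) : ℤ := f.a * x ^ 2 + f.b * x * y + f.c * y ^ 2

/-- The discriminant `b² - 4ac`. -/
def disc (f : BinForm) : ℤ := f.b ^ 2 - 4 * f.a * f.c

/-- The form is primitive: the only common divisors of its coefficients are units. -/
def IsPrimitive (f : BinForm) : Prop :=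
  ∀ d : ℤ, d ∣ f.a → d ∣ f.b → d ∣ f.c → IsUnit d

/-- Proper (Gauss) equivalence: `g` arises from `f` by an integral linear substitution
of determinant `1`. -/
def ProperEquiv (f g : BinForm) : Prop :=
  ∃ γ : SL(2, ℤ), ∀ x y : ℤ,
    g.eval x y = f.eval (γ 0 0 * x + γ 0 1 * y) (γ 1 0 * x + γ 1 1 * y)

theorem ProperEquiv.refl (f : BinForm) : ProperEquiv f f :=
  ⟨1, fun x y => by simp⟩

theorem ProperEquiv.symm {f g : BinForm} (h : ProperEquiv f g) : ProperEquiv g f := by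
  obtain ⟨γ, hγ⟩ := h
  refine ⟨γ⁻¹, fun x y => ?_⟩
  have hd : γ 0 0 * γ 1 1 - γ 0 1 * γ 1 0 = 1 := by
    have h1 := γ.det_coe
    rwa [Matrix.det_fin_two] at h1
  rw [hγ]
  simp only [Matrix.SpecialLinearGroup.SL2_inv_expl, Matrix.of_apply, Matrix.cons_val',
    Matrix.cons_val_zero, Matrix.cons_val_one, Matrix.cons_val_fin_one]
  congr 1
  · linear_combination (-x) * hd
  · linear_combination (-y) * hd

theorem ProperEquiv.trans {f g k : BinForm} (h₁ : ProperEquiv f g) (h₂ : ProperEquiv g k) :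
    ProperEquiv f k := by
  obtain ⟨γ, hγ⟩ := h₁
  obtain ⟨δ, hδ⟩ := h₂
  refine ⟨γ * δ, fun x y => ?_⟩
  rw [hδ, hγ]
  simp only [Matrix.SpecialLinearGroup.coe_mul, Matrix.mul_apply, Fin.sum_univ_two]
  congr 1 <;> ring

/-- The primitive binary quadratic forms of discriminant `d`. -/
abbrev Primitive (d : ℤ) : Type := {f : BinForm // f.IsPrimitive ∧ f.disc = d}

/-- Proper equivalence on the primitive forms of discriminant `d`. -/
def properSetoid (d : ℤ) : Setoid (Primitive d) where
  r f g := ProperEquiv f.1 g.1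
  iseqv := ⟨fun f => ProperEquiv.refl f.1, ProperEquiv.symm, ProperEquiv.trans⟩

end BinForm

/-- The class number `h(d)` of primitive binary quadratic forms of discriminant `d > 0`:
the number of their proper equivalence classes. -/
noncomputable def formClassNumber (d : ℤ) : ℕ :=
  Nat.card (Quotient (BinForm.properSetoid d))

/-- The assertion `v₁ h(4D) ≢ 0 (mod D)`, where `(u₁, v₁)` is the least solution of
`u² - D v² = 1` in positive integers. -/
def GAAC (D : ℕ) : Prop :=
  ∃ s : Pell.Solution₁ (D : ℤ), Pell.IsFundamental s ∧
    ¬ s.y * (formClassNumber (4 * (D : ℤ)) : ℤ) ≡ 0 [ZMOD (D : ℤ)]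

/-- The field `ℚ(√D)`, as a subfield of `ℝ`. -/
noncomputable def qSqrt (D : ℕ) : IntermediateField ℚ ℝ :=
  IntermediateField.adjoin ℚ {Real.sqrt (D : ℝ)}

/-- `ε` is the fundamental unit of the real field `K`: it is a unit of the ring of integers
of `K`, is larger than `1`, and every unit is of the form `± ε ^ k` with `k ∈ ℤ`. -/
def IsFundamentalUnit (K : IntermediateField ℚ ℝ) (ε : ℝ) : Prop :=
  1 < ε ∧ ∃ u : (𝓞 K)ˣ, (((u : 𝓞 K) : K) : ℝ) = ε ∧
    ∀ w : (𝓞 K)ˣ, ∃ k : ℤ, w = u ^ k ∨ w = -u ^ k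

/-! Squarefreeness forces `n = 2m`, hence `D ≡ 3 (mod 4)`. The integers of `ℚ(√D)` are then `ℤ[√D]`,
and norm `-1` is impossible mod 4, so the units are exactly the Pell solutions
(`pellUnit_surjective`); `(n, 1)` is fundamental because `y = 1` is minimal.

Since `v₁ = 1`, GAAC says `D ∤ h(4D)`, and `0 < h(4D) < D` suffices. Each class contains a form `(a,
2b, c)` with `2|b| ≤ |a| < n`, and `b` is odd when `a` is even; counting the triples (sign of `a`,
`|a|`, `b`) gives `h ≤ 3m² + m < 4m² - 1 = D` once `m ≥ 2` (`formClassNumber_pos_and_lt`).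

For infinitude, `D = (2m+1)(2m+3)` has coprime factors. At most about a quarter of odd numbers are
not squarefree, so neighbouring odd numbers are both squarefree arbitrarily far out. -/

theorem exists_eq_two_mul_of_squarefree {n D : ℕ} (h : D + 1 = n ^ 2) (hD : Squarefree D) :
    ∃ m, n = 2 * m ∧ 1 ≤ m ∧ D + 1 = 4 * m ^ 2 := by
  rcases Nat.even_or_odd' n with ⟨m, rfl | rfl⟩
  · refine ⟨m, rfl, ?_, by rw [h]; ring⟩
    rcases Nat.eq_zero_or_pos m with rfl | hm
    · simp at h
    · exact hm
  · exfalso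
    have h4 : 2 * 2 ∣ D := ⟨m * (m + 1), by nlinarith⟩
    have := hD 2 h4
    simp at this

theorem mod_four_eq_three {n D : ℕ} (h : D + 1 = n ^ 2) (hD : Squarefree D) : D % 4 = 3 := by
  obtain ⟨m, -, -, hm⟩ := exists_eq_two_mul_of_squarefree h hD
  omega

theorem not_isSquare_of_mod_four {D : ℕ} (h : D % 4 = 3) : ¬ IsSquare D := by
  rintro ⟨r, rfl⟩
  have : r % 4 < 4 := Nat.mod_lt _ (by norm_num)
  rw [Nat.mul_mod] at h
  interval_cases r % 4 <;> simp at h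

theorem irrational_sqrt_of_mod_four {D : ℕ} (h : D % 4 = 3) : Irrational (Real.sqrt (D : ℝ)) :=
  irrational_sqrt_natCast_iff.mpr (not_isSquare_of_mod_four h)

/-- The solution `(n, 1)` of Pell's equation for `D = n² - 1`. -/
def pellSolution (n D : ℕ) (h : D + 1 = n ^ 2) : Pell.Solution₁ (D : ℤ) :=
  Pell.Solution₁.mk n 1 (by
    have : (D : ℤ) + 1 = (n : ℤ) ^ 2 := by exact_mod_cast h
    linarith)

theorem isFundamental_pellSolution {n D : ℕ} (h : D + 1 = n ^ 2) (hD : 0 < D) :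
    Pell.IsFundamental (pellSolution n D h) := by
  have h' : (D : ℤ) + 1 = (n : ℤ) ^ 2 := by exact_mod_cast h
  refine ⟨?_, ?_, fun {b} hb => ?_⟩
  · simp only [pellSolution, Pell.Solution₁.x_mk]
    have : 1 < n := by nlinarith
    exact_mod_cast this
  · simp [pellSolution]
  · simp only [pellSolution, Pell.Solution₁.x_mk]
    have hy := Pell.Solution₁.y_ne_zero_of_one_lt_x hb
    have hy1 : 1 ≤ b.y ^ 2 := by have : 0 < b.y ^ 2 := by positivity
                                 omega
    have := b.prop
    have hD' : (0 : ℤ) < D := by exact_mod_cast hD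
    nlinarith

/-! ### Integers of a real quadratic field. -/

section QuadraticSubfield

variable {s : ℝ} {d : ℚ}

theorem rat_add_mul_eq_zero (hirr : Irrational s) {a b : ℚ} (h : (a : ℝ) + b * s = 0) :
    a = 0 ∧ b = 0 := by
  have hb : b = 0 := by
    by_contra hb
    refine (hirr.ratCast_mul hb).ne_rat (-a) ?_
    push_cast
    linarith
  subst hb
  exact ⟨by simpa using h, rfl⟩

/-- The elements `a + b s`, where `s² = d` is rational, form a subfield. -/
theorem exists_rat_of_mem_adjoin (hs : s ^ 2 = d) (hirr : Irrational s) {x : ℝ}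
    (hx : x ∈ IntermediateField.adjoin ℚ {s}) : ∃ a b : ℚ, x = a + b * s := by
  induction hx using IntermediateField.adjoin_induction with
  | mem x hx => exact ⟨0, 1, by simpa using hx⟩
  | algebraMap x => exact ⟨x, 0, by simp⟩
  | add x y _ _ hx hy =>
    obtain ⟨a, b, rfl⟩ := hx
    obtain ⟨a', b', rfl⟩ := hy
    exact ⟨a + a', b + b', by push_cast; ring⟩
  | inv x _ hx =>
    obtain ⟨a, b, rfl⟩ := hx
    by_cases h0 : (a : ℝ) + b * s = 0
    · exact ⟨0, 0, by simp [h0]⟩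
    have h1 : (a : ℝ) - b * s ≠ 0 := by
      intro h1
      obtain ⟨rfl, hb⟩ := rat_add_mul_eq_zero hirr (a := a) (b := -b) (by push_cast; linarith)
      rw [neg_eq_zero] at hb
      subst hb
      exact h0 (by simp)
    have hN : (a : ℝ) ^ 2 - d * b ^ 2 ≠ 0 := by
      have : (a : ℝ) ^ 2 - d * b ^ 2 = (a + b * s) * (a - b * s) := by rw [← hs]; ring
      rw [this]
      exact mul_ne_zero h0 h1
    refine ⟨a / (a ^ 2 - d * b ^ 2), -b / (a ^ 2 - d * b ^ 2), ?_⟩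
    push_cast
    rw [inv_eq_one_div, div_eq_iff h0]
    field_simp
    rw [← hs]
    ring
  | mul x y _ _ hx hy =>
    obtain ⟨a, b, rfl⟩ := hx
    obtain ⟨a', b', rfl⟩ := hy
    exact ⟨a * a' + d * b * b', a * b' + b * a', by push_cast; rw [← hs]; ring⟩

/-- Stands in for the conjugation automorphism: both evaluations are tracked together, using only
`s² = d`. -/
theorem aeval_conj (hs : s ^ 2 = d) (a b : ℚ) (p : Polynomial ℤ) :
    ∃ a' b' : ℚ, Polynomial.aeval ((a : ℝ) + b * s) p = a' + b' * s ∧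
      Polynomial.aeval ((a : ℝ) - b * s) p = a' - b' * s := by
  induction p using Polynomial.induction_on with
  | C k => exact ⟨k, 0, by simp, by simp⟩
  | add p q hp hq =>
    obtain ⟨a₁, b₁, h₁, h₁'⟩ := hp
    obtain ⟨a₂, b₂, h₂, h₂'⟩ := hq
    refine ⟨a₁ + a₂, b₁ + b₂, ?_, ?_⟩
    · rw [map_add, h₁, h₂]; push_cast; ring
    · rw [map_add, h₁', h₂']; push_cast; ring
  | monomial k c ih =>
    obtain ⟨a₁, b₁, h₁, h₁'⟩ := ih
    refine ⟨a₁ * a + d * b₁ * b, a₁ * b + b₁ * a, ?_, ?_⟩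
    · rw [pow_succ, ← mul_assoc, map_mul, h₁, Polynomial.aeval_X]; push_cast; rw [← hs]; ring
    · rw [pow_succ, ← mul_assoc, map_mul, h₁', Polynomial.aeval_X]; push_cast; rw [← hs]; ring

theorem isIntegral_conj (hs : s ^ 2 = d) (hirr : Irrational s) {a b : ℚ}
    (h : IsIntegral ℤ ((a : ℝ) + b * s)) : IsIntegral ℤ ((a : ℝ) - b * s) := by
  obtain ⟨p, hp, hp0⟩ := h
  obtain ⟨a', b', h₁, h₂⟩ := aeval_conj hs a b p
  rw [← Polynomial.aeval_def, h₁] at hp0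
  obtain ⟨rfl, rfl⟩ := rat_add_mul_eq_zero hirr hp0
  exact ⟨p, hp, by rw [← Polynomial.aeval_def, h₂]; simp⟩

end QuadraticSubfield

theorem exists_int_of_isIntegral_ratCast {q : ℚ} (h : IsIntegral ℤ (q : ℝ)) : ∃ k : ℤ, q = k := by
  have h' : IsIntegral ℤ q := by
    refine (isIntegral_algebraMap_iff (A := ℚ) (B := ℝ) (algebraMap ℚ ℝ).injective).mp ?_
    simpa using h
  obtain ⟨k, hk⟩ := IsIntegrallyClosed.isIntegral_iff.mp h'
  exact ⟨k, by simpa using hk.symm⟩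

theorem exists_int_of_squarefree_mul_sq {D : ℕ} (hD : Squarefree D) {q : ℚ} {m : ℤ}
    (h : (D : ℚ) * q ^ 2 = m) : ∃ k : ℤ, q = k := by
  have hq : (q.den : ℚ) ≠ 0 := by exact_mod_cast q.den_nz
  have h1 : (D : ℤ) * q.num ^ 2 = m * (q.den : ℤ) ^ 2 := by
    have : (D : ℚ) * q.num ^ 2 = m * (q.den : ℚ) ^ 2 := by
      rw [← h]
      nth_rewrite 2 [← Rat.num_div_den q]
      field_simp
    exact_mod_cast this
  have h2 : (q.den : ℤ) ^ 2 ∣ D := by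
    refine IsCoprime.dvd_of_dvd_mul_right (z := q.num ^ 2) ?_ ⟨m, by rw [h1]; ring⟩
    exact (Rat.isCoprime_num_den q).symm.pow
  have h3 : q.den * q.den ∣ D := by
    rw [← sq]
    exact_mod_cast h2
  have h4 : q.den = 1 := Nat.isUnit_iff.mp (hD _ h3)
  exact ⟨q.num, (Rat.den_eq_one_iff q).mp h4 |>.symm⟩

/-- For squarefree `D ≡ 3 (mod 4)` the integers of `ℚ(√D)` are the `x + y √D`, `x, y ∈ ℤ`. -/
theorem exists_int_of_isIntegral {D : ℕ} (hD : Squarefree D) (h4 : D % 4 = 3) {x : ℝ}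
    (hx : x ∈ qSqrt D) (hint : IsIntegral ℤ x) : ∃ a b : ℤ, x = a + b * Real.sqrt D := by
  have hs : Real.sqrt (D : ℝ) ^ 2 = ((D : ℚ) : ℝ) := by
    rw [Real.sq_sqrt (by positivity)]; simp
  have hirr := irrational_sqrt_of_mod_four h4
  obtain ⟨a, b, rfl⟩ := exists_rat_of_mem_adjoin hs hirr hx
  have hconj := isIntegral_conj hs hirr hint
  -- Trace and norm are rational and integral; then `D(2b)² = A² - 4N` makes `2b` an integer.
  obtain ⟨A, hA⟩ : ∃ k : ℤ, 2 * a = k := by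
    apply exists_int_of_isIntegral_ratCast
    rw [show ((2 * a : ℚ) : ℝ) = (a + b * Real.sqrt D) + (a - b * Real.sqrt D) by push_cast; ring]
    exact hint.add hconj
  obtain ⟨N, hN⟩ : ∃ k : ℤ, a ^ 2 - D * b ^ 2 = k := by
    apply exists_int_of_isIntegral_ratCast
    have hmul : ((a ^ 2 - D * b ^ 2 : ℚ) : ℝ) =
        (a + b * Real.sqrt D) * (a - b * Real.sqrt D) := by
      push_cast at hs ⊢
      linear_combination (b : ℝ) ^ 2 * hs
    rw [hmul]
    exact hint.mul hconj
  obtain ⟨B, hB⟩ : ∃ k : ℤ, 2 * b = k := by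
    refine exists_int_of_squarefree_mul_sq hD (m := A ^ 2 - 4 * N) ?_
    push_cast
    rw [← hA, ← hN]; ring
  have hAB : A ^ 2 - D * B ^ 2 = 4 * N := by
    have : (A : ℚ) ^ 2 - D * B ^ 2 = 4 * N := by rw [← hA, ← hB, ← hN]; ring
    exact_mod_cast this
  obtain ⟨e, he⟩ : ∃ e : ℤ, (D : ℤ) = 4 * e + 3 := ⟨D / 4, by omega⟩
  -- As `D ≡ -1 (mod 4)`, `4 ∣ A² + B²`, so both are even.
  have hpar : (∃ k, A = 2 * k) ∧ ∃ l, B = 2 * l := by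
    rcases Int.even_or_odd' A with ⟨k, rfl | rfl⟩ <;> rcases Int.even_or_odd' B with ⟨l, rfl | rfl⟩
    · exact ⟨⟨k, rfl⟩, ⟨l, rfl⟩⟩
    all_goals
      exfalso
      rw [he] at hAB
      ring_nf at hAB
      omega
  obtain ⟨⟨k, rfl⟩, ⟨l, rfl⟩⟩ := hpar
  refine ⟨k, l, ?_⟩
  have ha : a = k := by push_cast at hA; linarith
  have hb : b = l := by push_cast at hB; linarith
  rw [ha, hb]; simp

/-! ### Units and Pell's equation. -/

/-- `√D` as an algebraic integer of `ℚ(√D)`. -/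
noncomputable def sqrtInt (D : ℕ) : 𝓞 (qSqrt D) :=
  ⟨⟨Real.sqrt D, IntermediateField.mem_adjoin_simple_self ℚ _⟩, by
    refine ⟨Polynomial.X ^ 2 - Polynomial.C (D : ℤ),
      Polynomial.monic_X_pow_sub_C _ (by norm_num), ?_⟩
    apply Subtype.ext
    simp⟩

theorem coe_sqrtInt (D : ℕ) : ((sqrtInt D : qSqrt D) : ℝ) = Real.sqrt D := rfl

theorem sqrtInt_mul_self (D : ℕ) : sqrtInt D * sqrtInt D = ((D : ℤ) : 𝓞 (qSqrt D)) := by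
  apply NumberField.RingOfIntegers.ext
  apply Subtype.ext
  simp [coe_sqrtInt]

/-- Solutions of Pell's equation as units of the ring of integers. -/
noncomputable def pellUnit (D : ℕ) : Pell.Solution₁ (D : ℤ) →* (𝓞 (qSqrt D))ˣ :=
  (Units.map (Zsqrtd.lift ⟨sqrtInt D, sqrtInt_mul_self D⟩ : ℤ√(D : ℤ) →+* 𝓞 (qSqrt D))).comp
    Unitary.toUnits

theorem coe_pellUnit (D : ℕ) (t : Pell.Solution₁ (D : ℤ)) :
    (((pellUnit D t : 𝓞 (qSqrt D)) : qSqrt D) : ℝ) = t.x + t.y * Real.sqrt D := by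
  have : (pellUnit D t : 𝓞 (qSqrt D)) = (t.x : 𝓞 (qSqrt D)) + t.y * sqrtInt D := rfl
  rw [this]
  simp [coe_sqrtInt]

theorem unit_ext {D : ℕ} {u w : (𝓞 (qSqrt D))ˣ}
    (h : (((u : 𝓞 (qSqrt D)) : qSqrt D) : ℝ) = ((w : 𝓞 (qSqrt D)) : qSqrt D)) : u = w :=
  Units.ext (NumberField.RingOfIntegers.ext (Subtype.ext h))

theorem pellUnit_neg (D : ℕ) (t : Pell.Solution₁ (D : ℤ)) : pellUnit D (-t) = -pellUnit D t := by
  apply unit_ext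
  rw [coe_pellUnit]
  change _ = -(((pellUnit D t : 𝓞 (qSqrt D)) : qSqrt D) : ℝ)
  rw [coe_pellUnit, Pell.Solution₁.x_neg, Pell.Solution₁.y_neg]
  push_cast
  ring

theorem pellUnit_surjective {D : ℕ} (hD : Squarefree D) (h4 : D % 4 = 3) :
    Function.Surjective (pellUnit D) := by
  intro w
  have key : ∀ z : 𝓞 (qSqrt D), ∃ a b : ℤ, ((z : qSqrt D) : ℝ) = a + b * Real.sqrt D := fun z =>
    exists_int_of_isIntegral hD h4 (z : qSqrt D).2
      ((z.isIntegral_coe).map (IsScalarTower.toAlgHom ℤ (qSqrt D) ℝ))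
  obtain ⟨a, b, hab⟩ := key w
  obtain ⟨a', b', hab'⟩ := key (w⁻¹ : (𝓞 (qSqrt D))ˣ)
  have hirr := irrational_sqrt_of_mod_four h4
  have hs : Real.sqrt (D : ℝ) ^ 2 = D := Real.sq_sqrt (by positivity)
  have hmul : ((a : ℝ) + b * Real.sqrt D) * (a' + b' * Real.sqrt D) = 1 := by
    rw [← hab, ← hab', ← MulMemClass.coe_mul, ← map_mul, Units.mul_inv]
    simp
  have hz : (((a * a' + D * b * b' - 1 : ℤ) : ℚ) : ℝ) +
      ((a * b' + b * a' : ℤ) : ℚ) * Real.sqrt D = 0 := by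
    push_cast
    linear_combination hmul - (b : ℝ) * b' * hs
  obtain ⟨h1, h2⟩ := rat_add_mul_eq_zero hirr hz
  have h1' : a * a' + D * b * b' = 1 := by
    have : a * a' + D * b * b' - 1 = 0 := by exact_mod_cast h1
    linarith
  have h2' : a * b' + b * a' = 0 := by exact_mod_cast h2
  have hnorm : (a ^ 2 - D * b ^ 2) * (a' ^ 2 - D * b' ^ 2) = 1 := by
    linear_combination (a * a' + D * b * b' + 1) * h1' - D * (a * b' + b * a') * h2'
  -- Norm `-1` would give `a² + b² ≡ 3 (mod 4)`.
  have hN : a ^ 2 - D * b ^ 2 = 1 := by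
    rcases Int.isUnit_iff.mp (IsUnit.of_mul_eq_one _ hnorm) with h | h
    · exact h
    · exfalso
      obtain ⟨e, he⟩ : ∃ e : ℤ, (D : ℤ) = 4 * e + 3 := ⟨D / 4, by omega⟩
      rw [he] at h
      rcases Int.even_or_odd' a with ⟨k, rfl | rfl⟩ <;>
      rcases Int.even_or_odd' b with ⟨l, rfl | rfl⟩ <;>
      · ring_nf at h
        omega
  refine ⟨Pell.Solution₁.mk a b hN, unit_ext ?_⟩
  rw [coe_pellUnit, hab]
  simp

theorem isFundamentalUnit_of_squarefree {n D : ℕ} (h : D + 1 = n ^ 2) (hD : Squarefree D) :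
    IsFundamentalUnit (qSqrt D) ((n : ℝ) + Real.sqrt ((n : ℝ) ^ 2 - 1)) := by
  have h4 := mod_four_eq_three h hD
  have hn : (n : ℝ) ^ 2 - 1 = D := by
    have : (D : ℝ) + 1 = (n : ℝ) ^ 2 := by exact_mod_cast h
    linarith
  have hfund := isFundamental_pellSolution h (by omega)
  rw [hn]
  refine ⟨?_, pellUnit D (pellSolution n D h), ?_, fun w => ?_⟩
  · have h1 : (1 : ℝ) ≤ n := by
      have : n ≠ 0 := by rintro rfl; simp at h
      exact_mod_cast Nat.one_le_iff_ne_zero.mpr this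
    have h2 : 0 < Real.sqrt (D : ℝ) := Real.sqrt_pos.mpr (by exact_mod_cast (by omega : 0 < D))
    linarith
  · rw [coe_pellUnit]
    simp [pellSolution]
  · obtain ⟨t, rfl⟩ := pellUnit_surjective hD h4 w
    obtain ⟨k, rfl | rfl⟩ := hfund.eq_zpow_or_neg_zpow t
    · exact ⟨k, Or.inl (map_zpow _ _ _)⟩
    · exact ⟨k, Or.inr (by rw [pellUnit_neg, map_zpow])⟩

/-! ### Reduction of indefinite forms. -/

namespace BinForm

theorem properEquiv_translate (f : BinForm) (k : ℤ) :
    ProperEquiv f ⟨f.a, f.b + 2 * f.a * k, f.a * k ^ 2 + f.b * k + f.c⟩ :=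
  ⟨⟨!![1, k; 0, 1], by simp [Matrix.det_fin_two]⟩, fun x y => by simp [eval]; ring⟩

theorem properEquiv_swap (f : BinForm) : ProperEquiv f ⟨f.c, -f.b, f.a⟩ :=
  ⟨⟨!![0, -1; 1, 0], by simp [Matrix.det_fin_two]⟩, fun x y => by simp [eval]; ring⟩

/-- Every form of nonsquare discriminant is properly equivalent to one with `|b| ≤ |a| ≤ |c|`. -/
theorem exists_reduced (f : BinForm) (hf : ¬ IsSquare f.disc) :
    ∃ g : BinForm, ProperEquiv f g ∧ g.disc = f.disc ∧ g.a ≠ 0 ∧ |g.b| ≤ |g.a| ∧ |g.a| ≤ |g.c| := by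
  classical
  -- Take `|a|` minimal in the class. Translation keeps `a` and makes `|b| ≤ |a|`; swapping turns
  -- `c` into a first coefficient, so minimality gives `|a| ≤ |c|`.
  have hne : ∃ k : ℕ, ∃ g : BinForm, ProperEquiv f g ∧ g.disc = f.disc ∧ g.a.natAbs = k :=
    ⟨_, f, ProperEquiv.refl f, rfl, rfl⟩
  obtain ⟨g, hfg, hd, hg⟩ := Nat.find_spec hne
  have hmin : ∀ g' : BinForm, ProperEquiv f g' → g'.disc = f.disc → g.a.natAbs ≤ g'.a.natAbs :=
    fun g' h1 h2 => hg ▸ Nat.find_min' hne ⟨g', h1, h2, rfl⟩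
  have ha : g.a ≠ 0 := by
    intro h0
    apply hf
    rw [← hd, disc, h0]
    exact ⟨g.b, by ring⟩
  obtain ⟨k, hk⟩ : ∃ k : ℤ, |g.b + 2 * g.a * k| ≤ |g.a| := by
    refine ⟨-((g.b + |g.a|) / (2 * g.a)), ?_⟩
    have h1 := Int.emod_add_mul_ediv (g.b + |g.a|) (2 * g.a)
    have h2 := Int.emod_nonneg (g.b + |g.a|) (by omega : 2 * g.a ≠ 0)
    have h3 := Int.emod_lt_abs (g.b + |g.a|) (by omega : 2 * g.a ≠ 0)
    rw [abs_mul, abs_two] at h3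
    rw [abs_le, mul_neg]
    constructor <;> linarith
  have hg' := hfg.trans (properEquiv_translate g k)
  have hd' : disc ⟨g.a, g.b + 2 * g.a * k, g.a * k ^ 2 + g.b * k + g.c⟩ = f.disc := by
    rw [← hd]; simp only [disc]; ring
  refine ⟨_, hg', hd', ha, hk, ?_⟩
  have := hmin _ (hg'.trans (properEquiv_swap _)) (by rw [← hd']; simp only [disc]; ring)
  rw [Int.abs_eq_natAbs, Int.abs_eq_natAbs]
  exact_mod_cast this

/-- The coefficients of a form of discriminant `4D` with `D` odd that is reduced in the sense
of `exists_reduced`. -/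
theorem reduced_coeff_bounds {n D : ℕ} (h : D + 1 = n ^ 2) (hodd : Odd D) {g : BinForm}
    (hd : g.disc = 4 * D) (ha : g.a ≠ 0) (hba : |g.b| ≤ |g.a|) (hac : |g.a| ≤ |g.c|) :
    ∃ b : ℤ, g.b = 2 * b ∧ g.a.natAbs < n ∧ 2 * b.natAbs ≤ g.a.natAbs ∧
      (Even g.a.natAbs → Odd b) := by
  obtain ⟨a, b', c⟩ := g
  simp only [disc] at *
  obtain ⟨b, rfl⟩ : ∃ b, b' = 2 * b := by
    rcases Int.even_or_odd' b' with ⟨b, rfl | rfl⟩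
    · exact ⟨b, rfl⟩
    · ring_nf at hd; omega
  have hD : b ^ 2 - a * c = D := by linarith
  have hDpos : (0 : ℤ) < D := by exact_mod_cast hodd.pos
  have hsq : a ^ 2 ≤ |a| * |c| := by
    rw [← sq_abs, sq]; exact mul_le_mul_of_nonneg_left hac (abs_nonneg _)
  have hbsq : 4 * b ^ 2 ≤ a ^ 2 := by
    have := sq_le_sq.mpr hba
    linarith
  -- Otherwise `a² ≤ ac = b² - D < b² ≤ a²/4`. With `ac < 0`, instead `a² ≤ -ac = D - b² < n²`.
  have hneg : a * c < 0 := by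
    by_contra hnn
    push Not at hnn
    rw [← abs_mul, abs_of_nonneg hnn] at hsq
    nlinarith [sq_nonneg b]
  rw [← abs_mul, abs_of_neg hneg] at hsq
  rw [Int.abs_eq_natAbs, Int.abs_eq_natAbs] at hba
  refine ⟨b, rfl, ?_, by omega, fun he => ?_⟩
  · have h1 : a ^ 2 < (n : ℤ) ^ 2 := by
      have : (D : ℤ) + 1 = (n : ℤ) ^ 2 := by exact_mod_cast h
      nlinarith [sq_nonneg b]
    have := abs_lt_of_sq_lt_sq h1 (by positivity)
    rw [Int.abs_eq_natAbs] at this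
    exact_mod_cast this
  · have he' : Even a := Int.natAbs_even.mp he
    have : Odd (b ^ 2 - a * c) := by rw [hD]; exact_mod_cast hodd
    have h2 : Odd (b ^ 2) := by
      have := this.add_even (he'.mul_right c)
      simpa using this
    exact (Int.odd_pow' (by norm_num)).mp h2

end BinForm

/-! ### Bounding the class number. -/

/-- The possible halved middle coefficients of a reduced form with first coefficient `± k`. -/
noncomputable def middleCoeffs (k : ℕ) : Finset ℤ :=
  (Finset.Icc (-(k : ℤ)) k).filter fun b => 2 * b.natAbs ≤ k ∧ (Even k → Odd b)

theorem card_middleCoeffs_even (j : ℕ) : (middleCoeffs (2 * j)).card ≤ j + 1 := by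
  have hsub : middleCoeffs (2 * j) ⊆
      (Finset.Icc (-(((j : ℤ) + 1) / 2)) (((j : ℤ) - 1) / 2)).image fun t => 2 * t + 1 := by
    intro b hb
    simp only [middleCoeffs, Finset.mem_filter, Finset.mem_Icc] at hb
    obtain ⟨-, h1, h2⟩ := hb
    obtain ⟨t, rfl⟩ := h2 (even_two_mul j)
    refine Finset.mem_image.mpr ⟨t, Finset.mem_Icc.mpr ?_, rfl⟩
    omega
  refine (Finset.card_le_card hsub).trans (Finset.card_image_le.trans ?_)
  rw [Int.card_Icc]
  omega

theorem card_middleCoeffs_odd (j : ℕ) : (middleCoeffs (2 * j + 1)).card ≤ 2 * j + 1 := by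
  have hsub : middleCoeffs (2 * j + 1) ⊆ Finset.Icc (-(j : ℤ)) j := by
    intro b hb
    simp only [middleCoeffs, Finset.mem_filter, Finset.mem_Icc] at hb ⊢
    omega
  refine (Finset.card_le_card hsub).trans ?_
  rw [Int.card_Icc]
  omega

/-- The parity condition is essential: without it, each even `k = 2j` would contribute `2j + 1` and
the doubled sum would be `4m² > D`. -/
theorem two_mul_sum_card_middleCoeffs_le (m : ℕ) :
    2 * ∑ k ∈ Finset.range (2 * m), (middleCoeffs k).card ≤ 3 * m ^ 2 + m := by
  induction m with
  | zero => simp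
  | succ m ih =>
    rw [show 2 * (m + 1) = 2 * m + 1 + 1 by ring, Finset.sum_range_succ, Finset.sum_range_succ]
    have h1 := card_middleCoeffs_even m
    have h2 := card_middleCoeffs_odd m
    nlinarith

/-- The index set for reduced forms: the sign and the absolute value of `a`, and `b / 2`. -/
noncomputable def reducedIndices (n : ℕ) : Finset (Bool × (_ : ℕ) × ℤ) :=
  Finset.univ ×ˢ (Finset.range n).sigma middleCoeffs

theorem card_reducedIndices_le (m : ℕ) : (reducedIndices (2 * m)).card ≤ 3 * m ^ 2 + m := by
  rw [reducedIndices, Finset.card_product, Finset.card_sigma]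
  simpa using two_mul_sum_card_middleCoeffs_le m

/-- A chosen reduced representative is recovered from its index: `a ≠ 0`, so the sign and `|a|` give
`a`, and the discriminant then gives `c`. -/
theorem exists_injective_reducedIndices {n D : ℕ} (h : D + 1 = n ^ 2) (hodd : Odd D)
    (hsq : ¬ IsSquare D) :
    ∃ φ : Quotient (BinForm.properSetoid (4 * (D : ℤ))) → reducedIndices n,
      Function.Injective φ := by
  have hsq' : ¬ IsSquare (4 * (D : ℤ)) := by
    rintro ⟨r, hr⟩
    rcases Int.even_or_odd' r with ⟨t, rfl | rfl⟩
    · refine hsq ⟨t.natAbs, ?_⟩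
      zify
      rw [← sq, sq_abs]
      linarith
    · ring_nf at hr; omega
  have key : ∀ q : Quotient (BinForm.properSetoid (4 * (D : ℤ))), ∃ (g : BinForm) (b : ℤ),
      BinForm.ProperEquiv q.out.1 g ∧ g.disc = 4 * D ∧ g.a ≠ 0 ∧ g.b = 2 * b ∧
      g.a.natAbs < n ∧ 2 * b.natAbs ≤ g.a.natAbs ∧ (Even g.a.natAbs → Odd b) := by
    intro q
    have hdisc := q.out.2.2
    obtain ⟨g, h1, h2, h3, h4, h5⟩ := BinForm.exists_reduced q.out.1 (by rwa [hdisc])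
    rw [hdisc] at h2
    obtain ⟨b, hb⟩ := BinForm.reduced_coeff_bounds h hodd h2 h3 h4 h5
    exact ⟨g, b, h1, h2, h3, hb⟩
  choose g b hequiv hdisc ha hb hlt hle hpar using key
  refine ⟨fun q => ⟨(decide (0 < (g q).a), ⟨(g q).a.natAbs, b q⟩), ?_⟩, fun q₁ q₂ hq => ?_⟩
  · simp only [reducedIndices, middleCoeffs, Finset.mem_product, Finset.mem_univ, true_and,
      Finset.mem_sigma, Finset.mem_range, Finset.mem_filter, Finset.mem_Icc]
    have := hle q
    exact ⟨hlt q, by omega, hle q, hpar q⟩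
  · simp only [Subtype.mk.injEq, Prod.mk.injEq, decide_eq_decide, Sigma.mk.injEq, heq_eq_eq] at hq
    obtain ⟨h1, h2, h3⟩ := hq
    have haa : (g q₁).a = (g q₂).a := by
      have := ha q₁
      have := ha q₂
      omega
    have hbb : (g q₁).b = (g q₂).b := by rw [hb, hb, h3]
    have hcc : (g q₁).c = (g q₂).c := by
      have h5 := (hdisc q₁).trans (hdisc q₂).symm
      simp only [BinForm.disc] at h5
      rw [haa, hbb] at h5
      have : (4 * (g q₂).a) * (g q₁).c = (4 * (g q₂).a) * (g q₂).c := by linarith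
      exact mul_left_cancel₀ (mul_ne_zero (by norm_num) (ha q₂)) this
    have hgg : g q₁ = g q₂ := BinForm.ext haa hbb hcc
    rw [← Quotient.out_eq q₁, ← Quotient.out_eq q₂]
    refine Quotient.sound ?_
    have := hequiv q₂
    rw [← hgg] at this
    exact (hequiv q₁).trans this.symm

theorem formClassNumber_pos_and_lt {n D : ℕ} (h : D + 1 = n ^ 2) (hD : Squarefree D)
    (hD4 : 4 ≤ D) : 0 < formClassNumber (4 * (D : ℤ)) ∧ formClassNumber (4 * (D : ℤ)) < D := by
  have h4 := mod_four_eq_three h hD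
  obtain ⟨m, rfl, hm1, hm⟩ := exists_eq_two_mul_of_squarefree h hD
  obtain ⟨φ, hφ⟩ := exists_injective_reducedIndices h (Nat.odd_iff.mpr (by omega))
    (not_isSquare_of_mod_four h4)
  -- `Nat.card` is `0` on infinite types, so positivity needs finiteness as well as the principal
  -- form `x² - Dy²`.
  have : Finite (Quotient (BinForm.properSetoid (4 * (D : ℤ)))) := Finite.of_injective φ hφ
  have : Nonempty (Quotient (BinForm.properSetoid (4 * (D : ℤ)))) :=
    ⟨Quotient.mk _ ⟨⟨1, 0, -D⟩, fun d hd _ _ => isUnit_of_dvd_one hd, by simp [BinForm.disc]⟩⟩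
  refine ⟨Nat.card_pos, ?_⟩
  have h1 : formClassNumber (4 * (D : ℤ)) ≤ (reducedIndices (2 * m)).card := by
    have := Nat.card_le_card_of_injective φ hφ
    simpa [formClassNumber] using this
  have h2 := card_reducedIndices_le m
  have h3 : 2 ≤ m := by nlinarith
  nlinarith

theorem gaac_of_squarefree {n D : ℕ} (h : D + 1 = n ^ 2) (hD : Squarefree D) (hD4 : 4 ≤ D) :
    GAAC D := by
  refine ⟨pellSolution n D h, isFundamental_pellSolution h (by omega), fun hmod => ?_⟩
  obtain ⟨hpos, hlt⟩ := formClassNumber_pos_and_lt h hD hD4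
  simp only [pellSolution, Pell.Solution₁.y_mk, one_mul] at hmod
  have hdvd : D ∣ formClassNumber (4 * (D : ℤ)) := by
    exact_mod_cast Int.modEq_zero_iff_dvd.mp hmod
  exact absurd (Nat.le_of_dvd hpos hdvd) (by omega)

/-! ### Neighbouring squarefree odd numbers. -/

theorem card_filter_sq_dvd_le (M q : ℕ) (hq : 0 < q) :
    ((Finset.range M).filter fun m => q ∣ 2 * m + 1).card ≤ M / q + 1 := by
  have hsub : ((Finset.range M).filter fun m => q ∣ 2 * m + 1) ⊆
      (Finset.range (M / q + 1)).image fun t => (q * (2 * t + 1) - 1) / 2 := by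
    intro m hm
    simp only [Finset.mem_filter, Finset.mem_range] at hm
    obtain ⟨hlt, e, he⟩ := hm
    have hodd : Odd (q * e) := ⟨m, he.symm⟩
    obtain ⟨t, rfl⟩ := (Nat.odd_mul.mp hodd).2
    refine Finset.mem_image.mpr ⟨t, ?_, by rw [← he]; omega⟩
    rw [Finset.mem_range, Nat.lt_succ_iff, Nat.le_div_iff_mul_le hq]
    nlinarith
  refine (Finset.card_le_card hsub).trans (Finset.card_image_le.trans ?_)
  simp

/-- Telescopes via `1/(2j+1)² ≤ 1/(4j(j+1))`; the final `r` absorbs the `+1` terms. -/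
theorem sum_inv_sq_le (M r : ℕ) (hr : 1 ≤ r) :
    ∑ j ∈ Finset.Ico 1 r, ((M / (2 * j + 1) ^ 2 + 1 : ℕ) : ℚ) ≤
      M / 4 * (1 - 1 / r) + r := by
  induction r, hr using Nat.le_induction with
  | base => simp
  | succ r hr ih =>
    rw [Finset.sum_Ico_succ_top hr]
    have h1 : ((M / (2 * r + 1) ^ 2 : ℕ) : ℚ) ≤ M / 4 * (1 / r - 1 / (r + 1)) := by
      refine Nat.cast_div_le.trans ?_
      have hr' : (0 : ℚ) < r := by exact_mod_cast hr
      have : (M : ℚ) / 4 * (1 / r - 1 / (r + 1)) = M / (4 * r * (r + 1)) := by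
        field_simp; ring
      rw [this]
      push_cast
      gcongr
      nlinarith
    push_cast at ih h1 ⊢
    linarith

/-- Sieve by squares of odd `p = 2j + 1`: from `p² ≤ 2m + 1 < 4r²` follows `j < r`, so the rounding
errors total only `r`. -/
theorem card_filter_not_squarefree_le (r : ℕ) (hr : 1 ≤ r) :
    2 * ((Finset.range (2 * r ^ 2)).filter fun m => ¬ Squarefree (2 * m + 1)).card ≤
      r ^ 2 + 2 * r := by
  have hsub : ((Finset.range (2 * r ^ 2)).filter fun m => ¬ Squarefree (2 * m + 1)) ⊆
      (Finset.Ico 1 r).biUnion fun j =>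
        (Finset.range (2 * r ^ 2)).filter fun m => (2 * j + 1) ^ 2 ∣ 2 * m + 1 := by
    intro m hm
    simp only [Finset.mem_filter, Finset.mem_range] at hm
    obtain ⟨hlt, hns⟩ := hm
    rw [Nat.squarefree_iff_prime_squarefree] at hns
    push Not at hns
    obtain ⟨p, hp, hdvd⟩ := hns
    obtain ⟨e, he⟩ := hdvd
    have hodd : Odd (p * p * e) := ⟨m, he.symm⟩
    obtain ⟨j, rfl⟩ := (Nat.odd_mul.mp (Nat.odd_mul.mp hodd).1).1
    have hp1 := hp.one_lt
    have hle := Nat.le_of_dvd (by omega) ⟨e, he⟩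
    simp only [Finset.mem_biUnion, Finset.mem_Ico, Finset.mem_filter, Finset.mem_range]
    refine ⟨j, ⟨by omega, ?_⟩, hlt, e, by rw [he]; ring⟩
    nlinarith
  have h1 : (((Finset.range (2 * r ^ 2)).filter fun m => ¬ Squarefree (2 * m + 1)).card : ℚ) ≤
      ∑ j ∈ Finset.Ico 1 r, ((2 * r ^ 2 / (2 * j + 1) ^ 2 + 1 : ℕ) : ℚ) := by
    rw [← Nat.cast_sum]
    refine Nat.cast_le.mpr ((Finset.card_le_card hsub).trans (Finset.card_biUnion_le.trans ?_))
    exact Finset.sum_le_sum fun j _ => card_filter_sq_dvd_le _ _ (by positivity)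
  have h2 := sum_inv_sq_le (2 * r ^ 2) r hr
  have h3 : ((2 * r ^ 2 : ℕ) : ℚ) / 4 * (1 - 1 / r) ≤ r ^ 2 / 2 := by
    have : (0 : ℚ) ≤ 1 / r := by positivity
    push_cast
    nlinarith [sq_nonneg (r : ℚ)]
  have h4 : (2 : ℚ) * ((Finset.range (2 * r ^ 2)).filter fun m => ¬ Squarefree (2 * m + 1)).card ≤
      r ^ 2 + 2 * r := by linarith
  exact_mod_cast h4

/-- There are arbitrarily large `m` for which `2m + 1` and `2m + 3` are squarefree. -/
theorem exists_squarefree_pair (B : ℕ) :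
    ∃ m > B, Squarefree (2 * m + 1) ∧ Squarefree (2 * (m + 1) + 1) := by
  classical
  by_contra hcon
  push Not at hcon
  set r := B + 4 with hr
  set S := (Finset.range (2 * r ^ 2)).filter fun m => ¬ Squarefree (2 * m + 1) with hS
  -- If every pair fails, `m` or `m + 1` is in `S`; but `S` and its shift have at most `r² + 2r`
  -- elements together, fewer than the `2r² - B - 2` in the interval.
  have hsub : Finset.Ico (B + 1) (2 * r ^ 2 - 1) ⊆ S ∪ S.image (fun m => m - 1) := by
    intro m hm
    rw [Finset.mem_Ico] at hm
    rw [Finset.mem_union, Finset.mem_image]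
    by_cases h : Squarefree (2 * m + 1)
    · refine Or.inr ⟨m + 1, ?_, by simp⟩
      rw [hS, Finset.mem_filter, Finset.mem_range]
      exact ⟨by omega, hcon m (by omega) h⟩
    · left
      rw [hS, Finset.mem_filter, Finset.mem_range]
      exact ⟨by omega, h⟩
  have h1 := (Finset.card_le_card hsub).trans
    ((Finset.card_union_le _ _).trans (Nat.add_le_add_left Finset.card_image_le _))
  rw [Nat.card_Ico] at h1
  have h2 : 2 * S.card ≤ r ^ 2 + 2 * r := card_filter_not_squarefree_le r (by omega)
  have h3 : r ^ 2 + 2 * r + B + 2 < 2 * r ^ 2 := by rw [hr]; nlinarith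
  omega

theorem exists_squarefree_sq_sub_one (B : ℕ) :
    ∃ n D : ℕ, B < D ∧ D + 1 = n ^ 2 ∧ Squarefree D := by
  obtain ⟨m, hm, h1, h2⟩ := exists_squarefree_pair B
  refine ⟨2 * m + 2, (2 * m + 1) * (2 * (m + 1) + 1), by nlinarith, by ring, ?_⟩
  refine (Nat.squarefree_mul ?_).mpr ⟨h1, h2⟩
  have : Nat.Coprime (2 * m + 1) (2 * m + 1 + 2) := by
    rw [Nat.coprime_self_add_right]
    exact Nat.coprime_two_right.mpr ⟨m, rfl⟩
  exact this

theorem mainTheorem7 :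
    (∀ n D : ℕ, D + 1 = n ^ 2 → Squarefree D →
      IsFundamentalUnit (qSqrt D) ((n : ℝ) + Real.sqrt ((n : ℝ) ^ 2 - 1))) ∧
    (∃ D₀ : ℕ, ∀ n D : ℕ, D + 1 = n ^ 2 → Squarefree D → D₀ ≤ D →
      Odd D ∧ ¬ IsSquare D ∧ GAAC D) ∧
    {D : ℕ | (∃ n : ℕ, D + 1 = n ^ 2) ∧ Squarefree D ∧
      Odd D ∧ ¬ IsSquare D ∧ GAAC D}.Infinite := by
  have key : ∀ n D : ℕ, D + 1 = n ^ 2 → Squarefree D → 4 ≤ D →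
      Odd D ∧ ¬ IsSquare D ∧ GAAC D := fun n D h hD hD4 => by
    have h4 := mod_four_eq_three h hD
    exact ⟨Nat.odd_iff.mpr (by omega), not_isSquare_of_mod_four h4, gaac_of_squarefree h hD hD4⟩
  refine ⟨fun n D h hD => isFundamentalUnit_of_squarefree h hD, ⟨4, key⟩, ?_⟩
  refine Set.infinite_of_forall_exists_gt fun B => ?_
  obtain ⟨n, D, hlt, h, hD⟩ := exists_squarefree_sq_sub_one (B + 4)
  exact ⟨D, ⟨⟨n, h⟩, hD, key n D h hD (by omega)⟩, by omega⟩
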